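/- \textbf{Setting.} Let $\Sigma$ be a first-order signature, $\mathcal X$ a finite set of variables and $\mathcal I$ a set of fixed-point variables. Behavior expressions are $$e ::= 0 \mid\ !\alpha;e \mid\ ?\alpha;e \mid e\lor e \mid X \qquad (\alpha \text{ a term over } \Sigma,\mathcal X;\ X\in\mathcal I).$$ A system consists of an equation $X=S_X$ with a behavior expression $S_X$ for every $X\in\mathcal I$, and of a partial function $\kappa:\mathcal X\rightharpoonup\mathcal I$; the variables in $\kappa^{-}(X)=\{x\mid\kappa(x)=X\}$ are refreshed whenever $X$ is unfolded. Every variable $x$ has copies $x_0=x,x_1,x_2,\dots$ A \emph{fresh renaming} for $X$ is an injective map $\rho$ from $\kappa^{-}(X)$ to the set of copies of variables of $\kappa^{-}(X)$; $\mathrm{codom}(\rho)$ denotes its set of values. It is the identity if $\rho(x)=x$ for all $x$. In a position, substitutions are pushed through actions and choices and are suspended as $[\theta](X)$ in front of fixed-point variables. When $[\theta](X)$ is unfolded with $\rho$ it becomes $[\rho\circ\theta](S_X)$, where the former effect of $\theta$ on the variables of $\kappa^{-}(X)$ is discarded: $x\in\kappa^{-}(X)$ is replaced by $\rho(x)$,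 every other variable $y$ by $\theta(y)$. \textbf{The game $\mathcal G(t,u)$,} for behavior expressions $t,u$, starts in Abelard's position $\forall(t<u)$. The other positions are Eloise's positions $\exists(t<u)$ and $\exists(t<u,\,!\alpha)$, $\exists(t<u,\,?\alpha)$. The moves of Abelard are: \begin{itemize} \item $\forall(t_1\lor t_2<u)\to\forall(t_i<u)$, $i=1,2$; \item $\forall([\theta](X)<u)\to\exists([\theta](X)<u)$; \item $\forall(?\alpha;t<u)\to\exists(t<u,\,?\alpha)$; \item a move from $\forall(!\alpha;t<u)$, described below. \end{itemize} The moves of Eloise are: \begin{itemize} \item $\exists([\theta](X)<u)\to\forall([\rho\circ\theta](S_X)<u)$ and $\exists(t<[\theta](X),a)\to\exists(t<[\rho\circ\theta](S_X),a)$, for a fresh renaming $\rho$ for $X$ of her choice; \item $\exists(t<u_1\lor u_2,a)\to\exists(t<u_i,a)$, $i=1,2$; \item $\exists(t<{?\beta};u,\ !\alpha)\to\forall([\gamma](t)<[\sigma](u))$, where $\gamma$ is a ground substitution with domain $\mathrm{var}(\alpha)$ and $\sigma$, with domain $\mathrm{var}(\beta)$, solves $\sigma(\beta)=\gamma(\alpha)$;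 \item $\exists(t<{!\beta};u,\ ?\alpha)\to\forall([\sigma](t)<[\gamma](u))$, where $\gamma$ is a ground substitution with domain $\mathrm{var}(\beta)$ and $\sigma$, with domain $\mathrm{var}(\alpha)$, solves $\sigma(\alpha)=\gamma(\beta)$. \end{itemize} There are two conventions on who instantiates a message $!\alpha$ on the left. (1) Abelard does: he moves $\forall(!\alpha;t<u)\to\exists([\gamma](t)<u,\,!\gamma(\alpha))$ for a ground substitution $\gamma$ of his choice with domain $\mathrm{var}(\alpha)$, and there is nothing left to instantiate in Eloise's answer. (2) Eloise does: Abelard moves $\forall(!\alpha;t<u)\to\exists(t<u,\,!\alpha)$ and Eloise chooses $\gamma$ in her answer. A player who has to move and cannot do so loses; every infinite play is won by Eloise. The game $\widehat{\mathcal G}(t,u)$ is $\mathcal G(t,u)$ except that all fresh renamings chosen in a play must have pairwise disjoint codomains. A strategy of Eloise in $\mathcal G(t,u)$ is \emph{monotonic} if every fresh renaming that she chooses is the identity. \textbf{Proposition.} Under either of the conventions (1), (2), and for all behavior expressions $t,u$: Eloise has a winning strategy in $\widehat{\mathcal G}(t,u)$ if and only if she has a monotonic winning strategy in $\mathcal G(t,u)$.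 -/

import Mathlib

namespace FVA

universe u v w z

/-- The two players. -/
inductive Player
  | abelard
  | eloise

/-- The polarity of an action: sending (`!α`) or receiving (`?α`). -/
inductive Polarity
  | send
  | recv

/-- Behavior expressions `e ::= 0 | !α;e | ?α;e | e ∨ e | X` whose actions `α` are first-order terms
over the signature `L` with variables in `V`; `X` ranges over the fixed-point variables `I`. -/
inductive BExp (L : FirstOrder.Language.{u, v}) (V : Type w) (I : Type z)
  | nil : BExp L V I
  | act : Polarity → L.Term V → BExp L V I → BExp L V I
  | or : BExp L V I → BExp L V I → BExp L V I
  | fix : I → BExp L V I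

/-- A system of equations `X = S_X`, together with the refreshing function `κ`:
`κ x = some X` says that `x` is refreshed whenever `X` is unfolded, `κ x = none` that `x` is never
refreshed. So `κ⁻(X) = {x | κ x = some X}`. -/
structure System (L : FirstOrder.Language.{u, v}) (V : Type w) (I : Type z) where
  eqn : I → BExp L V I
  κ : V → Option I

/-- The variable names that occur in the game: `(x, p)` is the `p`-th copy of the variable `x`, and
`(x, 0)` is `x` itself. -/
abbrev Name (V : Type w) := V × ℕ

/-- Behavior expressions with substitutions, in normal form: substitutions have been pushed through
actions and choices, and are suspended in front of the fixed-point variables: `susp θ X` is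
`[θ](X)`, where `θ` is the composite of the renamings and substitutions met so far. -/
inductive SExp (L : FirstOrder.Language.{u, v}) (V : Type w) (I : Type z)
  | nil : SExp L V I
  | act : Polarity → L.Term (Name V) → SExp L V I → SExp L V I
  | or : SExp L V I → SExp L V I → SExp L V I
  | susp : (V → L.Term (Name V)) → I → SExp L V I

section

variable {L : FirstOrder.Language.{u, v}} {V : Type w} {I : Type z}

/-- The normal form of `[θ](e)`, for a behavior expression `e`. -/
def BExp.close (θ : V → L.Term (Name V)) : BExp L V I → SExp L V I
  | .nil => .nil
  | .act p α e => .act p (α.subst θ) (e.close θ)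
  | .or e f => .or (e.close θ) (f.close θ)
  | .fix X => .susp θ X

/-- The identity substitution: every variable is its own copy of index `0`. -/
def idSubst : V → L.Term (Name V) := fun x => .var (x, 0)

/-- The normal form of `[σ](e)`, for an expression with substitutions `e`. On `[θ](X)` it is
`[σ ∘ θ](X)`. -/
def SExp.subst (σ : Name V → L.Term (Name V)) : SExp L V I → SExp L V I
  | .nil => .nil
  | .act p α e => .act p (α.subst σ) (e.subst σ)
  | .or e f => .or (e.subst σ) (f.subst σ)
  | .susp θ X => .susp (fun x => (θ x).subst σ) X

/-- `γ` is a ground substitution with domain `D`: it sends the names in `D` to ground terms and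
fixes all others. -/
def IsGroundSubst [DecidableEq V] (γ : Name V → L.Term (Name V)) (D : Finset (Name V)) : Prop :=
  (∀ n ∈ D, (γ n).varFinset = ∅) ∧ ∀ n ∉ D, γ n = .var n

/-- `σ` is the solution of the matching problem of `β` against the ground term `a`:
its domain is `var(β)` and `σ(β) = a`. -/
def IsMatch [DecidableEq V] (σ : Name V → L.Term (Name V)) (β a : L.Term (Name V)) : Prop :=
  IsGroundSubst σ β.varFinset ∧ β.subst σ = a

/-- A fresh renaming for `X`: an injective map from `κ⁻(X)` to the copies of variables of `κ⁻(X)`.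
The codomains of fresh renamings for distinct `X`, `Y` are therefore disjoint. -/
structure FreshRenaming (κ : V → Option I) (X : I) where
  toFun : {x : V // κ x = some X} → Name V
  injective : Function.Injective toFun
  copy : ∀ x, κ (toFun x).1 = some X

/-- The set of names `ρ(x)`, `x ∈ κ⁻(X)`. -/
def FreshRenaming.codom {κ : V → Option I} {X : I} (ρ : FreshRenaming κ X) : Set (Name V) :=
  Set.range ρ.toFun

def FreshRenaming.IsIdentity {κ : V → Option I} {X : I} (ρ : FreshRenaming κ X) : Prop :=
  ∀ x, ρ.toFun x = (x.1, 0)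

/-- The composite `ρ ∘ θ` that instantiates `S_X` when `[θ](X)` is unfolded. What `θ` did to the
variables of `κ⁻(X)` (the previous fresh renaming for `X`, and the later substitutions of the names
that it introduced) is simplified away; these variables get the names chosen by `ρ`. On the
variables outside `κ⁻(X)` the action of `θ` is kept. -/
def refresh [DecidableEq I] {κ : V → Option I} {X : I} (ρ : FreshRenaming κ X)
    (θ : V → L.Term (Name V)) : V → L.Term (Name V) :=
  fun x => if h : κ x = some X then .var (ρ.toFun ⟨x, h⟩) else θ x

/-- Positions of the simulation game:
* `abelard t u`: Abelard's position `t < u`;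
* `unfold t u`: Eloise's position `t < u`, in which she has to unfold the head of `t`;
* `answer t u p α`: Eloise's position `t < u` in which she has to answer the action `p α`. -/
inductive Pos (L : FirstOrder.Language.{u, v}) (V : Type w) (I : Type z)
  | abelard : SExp L V I → SExp L V I → Pos L V I
  | unfold : SExp L V I → SExp L V I → Pos L V I
  | answer : SExp L V I → SExp L V I → Polarity → L.Term (Name V) → Pos L V I

def Pos.owner : Pos L V I → Player
  | .abelard _ _ => .abelard
  | .unfold _ _ => .eloise
  | .answer _ _ _ _ => .eloise

/-- The label of a move: the fresh renaming chosen in it, if there is one. -/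
abbrev Label (κ : V → Option I) := Option (Σ X : I, FreshRenaming κ X)

/-- The moves of the simulation game. The parameter `who` is the player who instantiates the
variables of a message `!α` sent by the left expression: either Abelard, when he plays it, or
Eloise, when she answers it. -/
inductive Step [DecidableEq V] [DecidableEq I] (E : System L V I) (who : Player) :
    Pos L V I → Label E.κ → Pos L V I → Prop
  /-- rule `A-∨` -/
  | a_or_left (t₁ t₂ u : SExp L V I) : Step E who (.abelard (.or t₁ t₂) u) none (.abelard t₁ u)
  | a_or_right (t₁ t₂ u : SExp L V I) : Step E who (.abelard (.or t₁ t₂) u) none (.abelard t₂ u)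
  /-- rule `A-Skip` -/
  | a_skip (θ : V → L.Term (Name V)) (X : I) (u : SExp L V I) :
      Step E who (.abelard (.susp θ X) u) none (.unfold (.susp θ X) u)
  /-- rule `A?-Comp` -/
  | a_recv (α : L.Term (Name V)) (t u : SExp L V I) :
      Step E who (.abelard (.act .recv α t) u) none (.answer t u .recv α)
  /-- rule `A!-Comp`, if Abelard instantiates the messages sent by the left expression -/
  | a_send_inst (α : L.Term (Name V)) (t u : SExp L V I) (γ : Name V → L.Term (Name V))
      (hwho : who = .abelard) (hγ : IsGroundSubst γ α.varFinset) :
      Step E who (.abelard (.act .send α t) u) none (.answer (t.subst γ) u .send (α.subst γ))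
  /-- rule `A!-Comp`, if Eloise instantiates the messages sent by the left expression -/
  | a_send (α : L.Term (Name V)) (t u : SExp L V I) (hwho : who = .eloise) :
      Step E who (.abelard (.act .send α t) u) none (.answer t u .send α)
  /-- rule `E-L_μ` -/
  | e_left (θ : V → L.Term (Name V)) (X : I) (u : SExp L V I) (ρ : FreshRenaming E.κ X) :
      Step E who (.unfold (.susp θ X) u) (some ⟨X, ρ⟩)
        (.abelard ((E.eqn X).close (refresh ρ θ)) u)
  /-- rule `E-R_μ` -/
  | e_right (t : SExp L V I) (θ : V → L.Term (Name V)) (X : I) (p : Polarity)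
      (α : L.Term (Name V)) (ρ : FreshRenaming E.κ X) :
      Step E who (.answer t (.susp θ X) p α) (some ⟨X, ρ⟩)
        (.answer t ((E.eqn X).close (refresh ρ θ)) p α)
  /-- rule `E-∨` -/
  | e_or_left (t u₁ u₂ : SExp L V I) (p : Polarity) (α : L.Term (Name V)) :
      Step E who (.answer t (.or u₁ u₂) p α) none (.answer t u₁ p α)
  | e_or_right (t u₁ u₂ : SExp L V I) (p : Polarity) (α : L.Term (Name V)) :
      Step E who (.answer t (.or u₁ u₂) p α) none (.answer t u₂ p α)
  /-- rule `E!`; if Abelard has instantiated `α` already, then `γ` is the identity -/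
  | e_send (t u : SExp L V I) (α β : L.Term (Name V)) (γ σ : Name V → L.Term (Name V))
      (hγ : IsGroundSubst γ α.varFinset) (hσ : IsMatch σ β (α.subst γ)) :
      Step E who (.answer t (.act .recv β u) .send α) none (.abelard (t.subst γ) (u.subst σ))
  /-- rule `E?` -/
  | e_recv (t u : SExp L V I) (α β : L.Term (Name V)) (γ σ : Name V → L.Term (Name V))
      (hγ : IsGroundSubst γ β.varFinset) (hσ : IsMatch σ α (β.subst γ)) :
      Step E who (.answer t (.act .send β u) .recv α) none (.abelard (t.subst σ) (u.subst γ))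

end

/-- A two-player game with labelled moves. A player who has to move but cannot do so loses, and
every infinite play is won by Eloise. -/
structure Game (P : Type*) (Λ : Type*) where
  init : P
  owner : P → Player
  step : P → Λ → P → Prop

namespace Game

variable {P Λ : Type*} (G : Game P Λ)

/-- The current position after a history (the list of the moves made, the latest one first). -/
def current : List (Λ × P) → P
  | [] => G.init
  | m :: _ => m.2

/-- A strategy for Eloise proposes a move after every history. -/
abbrev Strategy (P Λ : Type*) := List (Λ × P) → Λ × P

/-- The finite plays in which Eloise follows the strategy `s`. -/
inductive IsPlay (s : Strategy P Λ) : List (Λ × P) → Prop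
  | start : IsPlay s []
  | abelard (h : List (Λ × P)) (l : Λ) (q : P) : IsPlay s h → G.owner (G.current h) = .abelard →
      G.step (G.current h) l q → IsPlay s ((l, q) :: h)
  | eloise (h : List (Λ × P)) : IsPlay s h → G.owner (G.current h) = .eloise →
      G.step (G.current h) (s h).1 (s h).2 → IsPlay s (s h :: h)

/-- `s` is winning for Eloise: whenever it is her turn in a play that follows `s`, the move that `s`
proposes is legal. So every maximal play that follows `s` is infinite or ends where Abelard cannot
move. -/
def IsWinning (s : Strategy P Λ) : Prop :=
  ∀ h, G.IsPlay s h → G.owner (G.current h) = .eloise → G.step (G.current h) (s h).1 (s h).2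

end Game

section

variable {L : FirstOrder.Language.{u, v}} {V : Type w} {I : Type z} [DecidableEq V] [DecidableEq I]

/-- The simulation game `G(t, u)`. -/
def simGame (E : System L V I) (who : Player) (t u : BExp L V I) :
    Game (Pos L V I) (Label E.κ) where
  init := .abelard (t.close idSubst) (u.close idSubst)
  owner := Pos.owner
  step := Step E who

/-- The game `Ĝ(t, u)`: as `G(t, u)`, but all fresh renamings chosen in a play must have pairwise
disjoint codomains. A position carries the union of the codomains of those chosen so far. -/
def simGameHat (E : System L V I) (who : Player) (t u : BExp L V I) :
    Game (Pos L V I × Set (Name V)) (Label E.κ) where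
  init := (.abelard (t.close idSubst) (u.close idSubst), ∅)
  owner p := p.1.owner
  step p l q := Step E who p.1 l q.1 ∧
    match l with
    | none => q.2 = p.2
    | some ⟨_, ρ⟩ => Disjoint ρ.codom p.2 ∧ q.2 = p.2 ∪ ρ.codom

/-- A strategy in `G(t, u)` is monotonic if every fresh renaming that Eloise chooses when she
follows it is the identity. -/
def IsMonotonic (E : System L V I) (who : Player) (t u : BExp L V I)
    (s : Game.Strategy (Pos L V I) (Label E.κ)) : Prop :=
  ∀ h, (simGame E who t u).IsPlay s h →
    (simGame E who t u).owner ((simGame E who t u).current h) = .eloise →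
    ∀ (X : I) (ρ : FreshRenaming E.κ X), (s h).1 = some ⟨X, ρ⟩ → ρ.IsIdentity

end

end FVA

/-! The choice of fresh renamings never affects who can move where. Along a play, the environment
`θ` of either side sends each variable to a ground term or to a name of its own `κ`-class, distinct
variables never sharing a name. Unfolding `X` overwrites all variables of `κ⁻(X)` at once, so no old
name of that class survives in the environment to collide with a reused one
(`NameInjective.refresh`). Names common to the two sides are harmless, since each side receives its
own substitution. Hence positions that differ only in names (`PosSim`) simulate each other, whatever
renamings are substituted (`PosSim.exists_step`); the heart of this is that ground instantiations
and matches transfer (`EnvSim.exists_groundSubst`). Winning strategies are exchanged for safe sets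
of positions, which are then closed under `PosSim`. To reach a monotonic strategy, every renaming is
replaced by the identity; to reach disjoint codomains, by copies of an index not used before. The
latter works from any winning strategy, monotonic or not. -/

namespace FVA

universe u v w z

/-! ### Substitution in first-order terms -/

section Terms

variable {L : FirstOrder.Language.{u, v}} {A : Type*} {B : Type*} {C : Type*}

lemma term_subst_subst (t : L.Term A) (f : A → L.Term B) (g : B → L.Term C) :
    (t.subst f).subst g = t.subst fun x => (f x).subst g := by
  induction t with
  | var x => rfl
  | func F ts ih => simp only [FirstOrder.Language.Term.subst, ih]

lemma term_subst_congr [DecidableEq A] (t : L.Term A) {f g : A → L.Term B}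
    (h : ∀ x ∈ t.varFinset, f x = g x) : t.subst f = t.subst g := by
  induction t with
  | var x => exact h x (by simp [FirstOrder.Language.Term.varFinset])
  | func F ts ih =>
    simp only [FirstOrder.Language.Term.subst]
    congr 1
    funext i
    exact ih i fun x hx => h x (by simpa [FirstOrder.Language.Term.varFinset] using ⟨i, hx⟩)

lemma term_subst_var (t : L.Term A) : t.subst FirstOrder.Language.Term.var = t := by
  induction t with
  | var x => rfl
  | func F ts ih => simp only [FirstOrder.Language.Term.subst, ih]

lemma term_subst_eq_self [DecidableEq A] {t : L.Term A} (ht : t.varFinset = ∅)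
    (f : A → L.Term A) : t.subst f = t := by
  conv_rhs => rw [← term_subst_var t]
  exact term_subst_congr t (by simp [ht])

lemma mem_varFinset_subst [DecidableEq A] [DecidableEq B] (t : L.Term A) (f : A → L.Term B)
    (n : B) : n ∈ (t.subst f).varFinset ↔ ∃ x ∈ t.varFinset, n ∈ (f x).varFinset := by
  induction t with
  | var x => simp [FirstOrder.Language.Term.subst, FirstOrder.Language.Term.varFinset]
  | func F ts ih =>
    simp only [FirstOrder.Language.Term.subst, FirstOrder.Language.Term.varFinset, Finset.mem_biUnion, Finset.mem_univ,
      true_and, ih]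
    tauto

end Terms

/-! ### Expressions under substitution; injectivity on names -/

section Expressions

variable {L : FirstOrder.Language.{u, v}} {V : Type w} {I : Type z}

lemma BExp.close_subst (e : BExp L V I) (θ : V → L.Term (Name V))
    (σ : Name V → L.Term (Name V)) :
    (e.close θ).subst σ = e.close fun x => (θ x).subst σ := by
  induction e with
  | nil => rfl
  | act p α e ih => simp only [BExp.close, SExp.subst, ih, term_subst_subst]
  | or e f ihe ihf => simp only [BExp.close, SExp.subst, ihe, ihf]
  | fix X => rfl

/-- No two variables are sent to the same name. -/
def NameInjective (θ : V → L.Term (Name V)) : Prop :=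
  ∀ x y n, θ x = .var n → θ y = .var n → x = y

/-- A renamed variable gets a name of class `X`, while a kept variable is outside `κ⁻(X)` and its
name, if any, has its own class, so the two cannot meet. Freshness of `ρ` relative to earlier
renamings plays no role. -/
lemma NameInjective.refresh [DecidableEq I] {κ : V → Option I}
    {θ : V → L.Term (Name V)} {X : I} (ρ : FreshRenaming κ X)
    (hinj : NameInjective θ) (hκ : ∀ x n, θ x = .var n → κ n.1 = κ x) :
    NameInjective (refresh ρ θ) := by
  intro x y n hx hy
  unfold FVA.refresh at hx hy
  split_ifs at hx hy with h₁ h₂ h₂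
  · have h := hx.trans hy.symm
    simp only [FirstOrder.Language.Term.var.injEq] at h
    simpa using ρ.injective h
  · simp only [FirstOrder.Language.Term.var.injEq] at hx
    exact absurd ((hκ y n hy).symm.trans (hx ▸ ρ.copy _)) h₂
  · simp only [FirstOrder.Language.Term.var.injEq] at hy
    exact absurd ((hκ x n hx).symm.trans (hy ▸ ρ.copy _)) h₁
  · exact hinj x y n hx hy

end Expressions

/-! ### Environments up to the choice of names -/

section Environments

variable {L : FirstOrder.Language.{u, v}} {V : Type w} {I : Type z} [DecidableEq V]

/-- Two substitutions that agree up to the choice of names: every variable is sent by both to the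
same ground term, or by both to names of its own `κ`-class, and names are not shared. -/
structure EnvSim (κ : V → Option I) (θ θ' : V → L.Term (Name V)) : Prop where
  cases : ∀ x, ((θ x).varFinset = ∅ ∧ θ' x = θ x) ∨
    ∃ n n' : Name V, θ x = .var n ∧ θ' x = .var n' ∧ κ n.1 = κ x ∧ κ n'.1 = κ x
  injective : NameInjective θ
  injective' : NameInjective θ'

variable {κ : V → Option I} {θ θ' : V → L.Term (Name V)}

lemma EnvSim.symm (h : EnvSim κ θ θ') : EnvSim κ θ' θ where
  cases x := by
    rcases h.cases x with ⟨h₁, h₂⟩ | ⟨n, n', h₁, h₂, h₃, h₄⟩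
    · exact .inl ⟨h₂ ▸ h₁, h₂.symm⟩
    · exact .inr ⟨n', n, h₂, h₁, h₄, h₃⟩
  injective := h.injective'
  injective' := h.injective

lemma EnvSim.idSubst (κ : V → Option I) : EnvSim (L := L) κ idSubst idSubst := by
  have hinj : NameInjective (L := L) (V := V) FVA.idSubst := by
    intro x y n hx hy
    have h := hx.trans hy.symm
    simpa [FVA.idSubst] using h
  exact ⟨fun x => .inr ⟨(x, 0), (x, 0), rfl, rfl, rfl, rfl⟩, hinj, hinj⟩

lemma EnvSim.class_eq (h : EnvSim κ θ θ') {x : V} {n : Name V} (hx : θ x = .var n) :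
    κ n.1 = κ x := by
  rcases h.cases x with ⟨h₁, -⟩ | ⟨m, m', h₁, -, h₃, -⟩
  · simp [hx, FirstOrder.Language.Term.varFinset] at h₁
  · rw [hx, FirstOrder.Language.Term.var.injEq] at h₁
    exact h₁ ▸ h₃

lemma EnvSim.refresh [DecidableEq I] {X : I} (h : EnvSim κ θ θ') (ρ ρ' : FreshRenaming κ X) :
    EnvSim κ (refresh ρ θ) (refresh ρ' θ') where
  cases x := by
    by_cases hx : κ x = some X
    · exact .inr ⟨ρ.toFun ⟨x, hx⟩, ρ'.toFun ⟨x, hx⟩, by simp [FVA.refresh, hx],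
        by simp [FVA.refresh, hx], (ρ.copy _).trans hx.symm, (ρ'.copy _).trans hx.symm⟩
    · simpa [FVA.refresh, hx] using h.cases x
  injective := h.injective.refresh ρ fun _ _ => h.class_eq
  injective' := h.injective'.refresh ρ' fun _ _ => h.symm.class_eq

/-- Ground values contribute no names and no other variable has the name `n`, so `n` can enter the
instantiated term only through `x`. -/
lemma EnvSim.mem_varFinset (h : EnvSim κ θ θ') (a : L.Term V) {x : V} {n : Name V}
    (hx : θ x = .var n) : n ∈ (a.subst θ).varFinset ↔ x ∈ a.varFinset := by
  rw [mem_varFinset_subst]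
  constructor
  · rintro ⟨y, hy, hn⟩
    rcases h.cases y with ⟨h₁, -⟩ | ⟨m, m', h₁, -⟩
    · simp [h₁] at hn
    · have hnm : n = m := by simpa [h₁, FirstOrder.Language.Term.varFinset] using hn
      exact h.injective x y n hx (hnm ▸ h₁) ▸ hy
  · exact fun hxa => ⟨x, hxa, by simp [hx, FirstOrder.Language.Term.varFinset]⟩

/-- A ground instantiation of a term can be copied along a change of names. -/
lemma EnvSim.exists_groundSubst (h : EnvSim κ θ θ') (a : L.Term V)
    {γ : Name V → L.Term (Name V)} (hγ : IsGroundSubst γ (a.subst θ).varFinset) :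
    ∃ γ', IsGroundSubst γ' (a.subst θ').varFinset ∧
      (a.subst θ').subst γ' = (a.subst θ).subst γ ∧
      EnvSim κ (fun x => (θ x).subst γ) (fun x => (θ' x).subst γ') := by
  classical
  -- A name of the `θ'` side is traced back to its variable in `a`, unique by injectivity, and takes
  -- the value that `γ` gives there.
  let γ' : Name V → L.Term (Name V) := fun n =>
    if hn : ∃ x ∈ a.varFinset, θ' x = .var n then (θ hn.choose).subst γ else .var n
  have hmem : ∀ x n n', θ x = .var n → θ' x = .var n' → x ∈ a.varFinset →
      γ' n' = γ n ∧ (γ n).varFinset = ∅ := by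
    intro x n n' hx hx' hxa
    have hn : ∃ x ∈ a.varFinset, θ' x = .var n' := ⟨x, hxa, hx'⟩
    have hc : hn.choose = x := h.injective' _ _ _ hn.choose_spec.2 hx'
    refine ⟨?_, hγ.1 n ((h.mem_varFinset a hx).2 hxa)⟩
    simp only [γ', dif_pos hn, hc, hx, FirstOrder.Language.Term.subst]
  have hnmem : ∀ x n n', θ x = .var n → θ' x = .var n' → x ∉ a.varFinset →
      γ' n' = .var n' ∧ γ n = .var n := by
    intro x n n' hx hx' hxa
    refine ⟨dif_neg ?_, hγ.2 n (mt (h.mem_varFinset a hx).1 hxa)⟩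
    rintro ⟨y, hya, hy⟩
    exact hxa (h.injective' _ _ _ hy hx' ▸ hya)
  have hcases : ∀ x, (((θ x).subst γ).varFinset = ∅ ∧ (θ' x).subst γ' = (θ x).subst γ) ∨
      x ∉ a.varFinset ∧ (θ x).subst γ = θ x ∧ (θ' x).subst γ' = θ' x ∧
        ∃ n n' : Name V, θ x = .var n ∧ θ' x = .var n' ∧ κ n.1 = κ x ∧ κ n'.1 = κ x := by
    intro x
    rcases h.cases x with ⟨h₁, h₂⟩ | ⟨n, n', h₁, h₂, h₃⟩
    · left
      rw [h₂, term_subst_eq_self h₁, term_subst_eq_self h₁]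
      exact ⟨h₁, rfl⟩
    · by_cases hxa : x ∈ a.varFinset
      · left
        obtain ⟨h₄, h₅⟩ := hmem x n n' h₁ h₂ hxa
        simp only [h₁, h₂, FirstOrder.Language.Term.subst]
        exact ⟨h₅, h₄⟩
      · right
        obtain ⟨h₄, h₅⟩ := hnmem x n n' h₁ h₂ hxa
        exact ⟨hxa, by simpa only [h₁, FirstOrder.Language.Term.subst] using h₅,
          by simpa only [h₂, FirstOrder.Language.Term.subst] using h₄, n, n', h₁, h₂, h₃⟩
  refine ⟨γ', ⟨fun n hn => ?_, fun n hn => dif_neg ?_⟩, ?_, ⟨fun x => ?_, ?_, ?_⟩⟩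
  · obtain ⟨x, hxa, hx⟩ := (mem_varFinset_subst a θ' n).1 hn
    rcases h.cases x with ⟨h₁, h₂⟩ | ⟨m, m', h₁, h₂, -⟩
    · simp [h₂, h₁] at hx
    · have hnm : n = m' := by simpa [h₂, FirstOrder.Language.Term.varFinset] using hx
      obtain ⟨h₄, h₅⟩ := hmem x m m' h₁ h₂ hxa
      rw [hnm, h₄, h₅]
  · rintro ⟨x, hxa, hx⟩
    exact hn ((h.symm.mem_varFinset a hx).2 hxa)
  · rw [term_subst_subst, term_subst_subst]
    refine term_subst_congr a fun x hxa => ?_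
    rcases hcases x with ⟨-, h₂⟩ | ⟨h₁, -⟩
    · exact h₂
    · exact absurd hxa h₁
  · rcases hcases x with h₁ | ⟨-, h₁, h₂, h₃⟩
    · exact .inl h₁
    · exact .inr (by simpa only [h₁, h₂] using h₃)
  · intro x y n hx hy
    -- Instantiation only turns names into ground terms, so a name still present was already there.
    have hvar : ∀ z, (θ z).subst γ = .var n → θ z = .var n := by
      intro z hz
      rcases hcases z with ⟨h₁, -⟩ | ⟨-, h₁, -⟩
      · simp [hz, FirstOrder.Language.Term.varFinset] at h₁
      · exact h₁ ▸ hz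
    exact h.injective x y n (hvar x hx) (hvar y hy)
  · intro x y n hx hy
    have hvar : ∀ z, (θ' z).subst γ' = .var n → θ' z = .var n := by
      intro z hz
      rcases hcases z with ⟨h₁, h₂⟩ | ⟨-, -, h₁, -⟩
      · simp [← h₂, hz, FirstOrder.Language.Term.varFinset] at h₁
      · exact h₁ ▸ hz
    exact h.injective' x y n (hvar x hx) (hvar y hy)

end Environments

/-! ### Simulation between positions -/

section Positions

variable {L : FirstOrder.Language.{u, v}} {V : Type w} {I : Type z} [DecidableEq V]

/-- Positions that arise from the same behavior expressions by substitutions that agree up to the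
choice of names. -/
inductive PosSim (κ : V → Option I) : Pos L V I → Pos L V I → Prop
  | abelard (e f : BExp L V I) {θ θ' φ φ' : V → L.Term (Name V)} (hθ : EnvSim κ θ θ')
      (hφ : EnvSim κ φ φ') :
      PosSim κ (.abelard (e.close θ) (f.close φ)) (.abelard (e.close θ') (f.close φ'))
  | unfold (e f : BExp L V I) {θ θ' φ φ' : V → L.Term (Name V)} (hθ : EnvSim κ θ θ')
      (hφ : EnvSim κ φ φ') :
      PosSim κ (.unfold (e.close θ) (f.close φ)) (.unfold (e.close θ') (f.close φ'))
  | answer (e f : BExp L V I) (p : Polarity) (a : L.Term V) {θ θ' φ φ' : V → L.Term (Name V)}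
      (hθ : EnvSim κ θ θ') (hφ : EnvSim κ φ φ') :
      PosSim κ (.answer (e.close θ) (f.close φ) p (a.subst θ))
        (.answer (e.close θ') (f.close φ') p (a.subst θ'))

variable {κ : V → Option I} {p q : Pos L V I}

lemma PosSim.symm (h : PosSim κ p q) : PosSim κ q p := by
  cases h with
  | abelard e f hθ hφ => exact .abelard e f hθ.symm hφ.symm
  | unfold e f hθ hφ => exact .unfold e f hθ.symm hφ.symm
  | answer e f p a hθ hφ => exact .answer e f p a hθ.symm hφ.symm

lemma PosSim.owner_eq (h : PosSim κ p q) : p.owner = q.owner := by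
  cases h <;> rfl

lemma Step.label_eq_none [DecidableEq I] {E : System L V I} {who : Player} {l : Label E.κ}
    (h : Step E who p l q) (hp : p.owner = .abelard) : l = none := by
  cases h <;> first | rfl | cases hp

/-- Every move can be copied to a similar position, with any other choice of fresh renamings. -/
lemma PosSim.exists_step [DecidableEq I] {E : System L V I} {who : Player} {p' : Pos L V I}
    {l : Label E.κ} (h : PosSim E.κ p q) (hs : Step E who p l p')
    (c : ∀ X, FreshRenaming E.κ X) :
    ∃ q', Step E who q (l.map fun r => ⟨r.1, c r.1⟩) q' ∧ PosSim E.κ p' q' := by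
  cases h with
  | abelard e f hθ hφ =>
    cases e with
    | nil => cases hs
    | fix X =>
      cases hs
      exact ⟨_, .a_skip _ _ _, .unfold (.fix X) f hθ hφ⟩
    | or e₁ e₂ =>
      cases hs with
      | a_or_left => exact ⟨_, .a_or_left _ _ _, .abelard e₁ f hθ hφ⟩
      | a_or_right => exact ⟨_, .a_or_right _ _ _, .abelard e₂ f hθ hφ⟩
    | act p a e =>
      cases hs with
      | a_recv => exact ⟨_, .a_recv _ _ _, .answer e f .recv a hθ hφ⟩
      | a_send _ _ _ hwho => exact ⟨_, .a_send _ _ _ hwho, .answer e f .send a hθ hφ⟩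
      | a_send_inst _ _ _ γ hwho hγ =>
        obtain ⟨γ', hγ', -, hsim⟩ := hθ.exists_groundSubst a hγ
        refine ⟨_, .a_send_inst _ _ _ γ' hwho hγ', ?_⟩
        simp only [BExp.close_subst, term_subst_subst]
        exact .answer e f .send a hsim hφ
  | unfold e f hθ hφ =>
    cases e with
    | fix X =>
      cases hs with
      | e_left _ _ _ ρ =>
        exact ⟨_, .e_left _ _ _ (c X), .abelard _ f (hθ.refresh ρ (c X)) hφ⟩
    | _ => cases hs
  | answer e f p a hθ hφ =>
    cases f with
    | nil => cases hs
    | fix X =>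
      cases hs with
      | e_right _ _ _ _ _ ρ =>
        exact ⟨_, .e_right _ _ _ _ _ (c X), .answer e _ p a hθ (hφ.refresh ρ (c X))⟩
    | or f₁ f₂ =>
      cases hs with
      | e_or_left => exact ⟨_, .e_or_left _ _ _ _ _, .answer e f₁ p a hθ hφ⟩
      | e_or_right => exact ⟨_, .e_or_right _ _ _ _ _, .answer e f₂ p a hθ hφ⟩
    | act r b f =>
      cases hs with
      | e_send _ _ _ _ γ σ hγ hσ =>
        obtain ⟨γ', hγ', heq, hsim⟩ := hθ.exists_groundSubst a hγ
        -- A match is a ground substitution on the variables of its pattern, so it is copied in the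
        -- same way; both copies preserve the instantiated messages, hence also the matching
        -- equation.
        obtain ⟨σ', hσ', heq', hsim'⟩ := hφ.exists_groundSubst b hσ.1
        refine ⟨_, .e_send _ _ _ _ γ' σ' hγ' ⟨hσ', heq'.trans (hσ.2.trans heq.symm)⟩, ?_⟩
        simp only [BExp.close_subst]
        exact .abelard e f hsim hsim'
      | e_recv _ _ _ _ γ σ hγ hσ =>
        obtain ⟨γ', hγ', heq, hsim⟩ := hφ.exists_groundSubst b hγ
        obtain ⟨σ', hσ', heq', hsim'⟩ := hθ.exists_groundSubst a hσ.1
        refine ⟨_, .e_recv _ _ _ _ γ' σ' hγ' ⟨hσ', heq'.trans (hσ.2.trans heq.symm)⟩, ?_⟩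
        simp only [BExp.close_subst]
        exact .abelard e f hsim' hsim

end Positions

/-! ### Winning strategies and safe sets -/

namespace Game

variable {P Λ : Type*} {G : Game P Λ}

/-- The positions in `W` are safe for Eloise: Abelard cannot leave `W`, and Eloise can always move
inside `W`, by a move with label in `Q`. -/
structure IsSafe (G : Game P Λ) (Q : Λ → Prop) (W : Set P) : Prop where
  init : G.init ∈ W
  abelard : ∀ p ∈ W, G.owner p = .abelard → ∀ l q, G.step p l q → q ∈ W
  eloise : ∀ p ∈ W, G.owner p = .eloise → ∃ l q, Q l ∧ G.step p l q ∧ q ∈ W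

lemma IsWinning.isSafe {s : Strategy P Λ} (hs : G.IsWinning s) :
    G.IsSafe (fun _ => True) {p | ∃ h, G.IsPlay s h ∧ G.current h = p} where
  init := ⟨[], .start, rfl⟩
  abelard := by
    rintro _ ⟨h, hh, rfl⟩ ho l q hst
    exact ⟨_, .abelard h l q hh ho hst, rfl⟩
  eloise := by
    rintro _ ⟨h, hh, rfl⟩ ho
    exact ⟨_, _, trivial, hs h hh ho, _, .eloise h hh ho (hs h hh ho), rfl⟩

/-- A safe move chosen once for each position gives a positional strategy that never leaves `W`;
infinite plays need no care, as Eloise wins them. -/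
lemma IsSafe.exists_isWinning [Nonempty Λ] {Q : Λ → Prop} {W : Set P} (hW : G.IsSafe Q W) :
    ∃ s, G.IsWinning s ∧
      ∀ h, G.IsPlay s h → G.owner (G.current h) = .eloise → Q (s h).1 := by
  have hex : ∀ p, ∃ m : Λ × P, p ∈ W → G.owner p = .eloise →
      Q m.1 ∧ G.step p m.1 m.2 ∧ m.2 ∈ W := by
    intro p
    by_cases hp : p ∈ W ∧ G.owner p = .eloise
    · obtain ⟨l, q, h⟩ := hW.eloise p hp.1 hp.2
      exact ⟨(l, q), fun _ _ => h⟩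
    · exact ⟨(Classical.arbitrary Λ, p), fun h₁ h₂ => absurd ⟨h₁, h₂⟩ hp⟩
  choose m hm using hex
  have hmem : ∀ h, G.IsPlay (fun h => m (G.current h)) h → G.current h ∈ W := by
    intro h hh
    induction hh with
    | start => exact hW.init
    | abelard h l q _ ho hst ih => exact hW.abelard _ ih ho l q hst
    | eloise h _ ho _ ih => exact (hm _ ih ho).2.2
  exact ⟨fun h => m (G.current h), fun h hh ho => (hm _ (hmem h hh) ho).2.1,
    fun h hh ho => (hm _ (hmem h hh) ho).1⟩

end Game

section Renamings

variable {V : Type w} {I : Type z}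

/-- The fresh renaming that sends every variable to its `k`-th copy. -/
def FreshRenaming.copyAt (κ : V → Option I) (k : ℕ) (X : I) : FreshRenaming κ X where
  toFun x := (x.1, k)
  injective _ _ h := Subtype.ext (congrArg Prod.fst h)
  copy x := x.2

end Renamings

end FVA

theorem mainTheorem2 {L : FirstOrder.Language} {V : Type*} {I : Type*}
    [Finite V] [DecidableEq V] [DecidableEq I]
    (E : FVA.System L V I) (who : FVA.Player) (t u : FVA.BExp L V I) :
    (∃ s, (FVA.simGameHat E who t u).IsWinning s) ↔
      ∃ s, (FVA.simGame E who t u).IsWinning s ∧ FVA.IsMonotonic E who t u s := by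
  have hinit : FVA.PosSim E.κ (FVA.simGame E who t u).init (FVA.simGame E who t u).init :=
    .abelard t u (.idSubst E.κ) (.idSubst E.κ)
  constructor
  · rintro ⟨s, hs⟩
    have hW := hs.isSafe
    generalize {p | ∃ h, (FVA.simGameHat E who t u).IsPlay s h ∧
      (FVA.simGameHat E who t u).current h = p} = W at hW
    have hsafe : (FVA.simGame E who t u).IsSafe
        (fun l => ∀ X (ρ : FVA.FreshRenaming E.κ X), l = some ⟨X, ρ⟩ → ρ.IsIdentity)
        {q | ∃ p ∈ W, FVA.PosSim E.κ p.1 q} := by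
      refine ⟨⟨_, hW.init, hinit⟩, ?_, ?_⟩
      · rintro q ⟨p, hp, hpq⟩ ho l q' hst
        -- The renamings supplied here are irrelevant: Abelard's moves carry none.
        obtain ⟨p', hst', hsim⟩ := hpq.symm.exists_step hst (FVA.FreshRenaming.copyAt E.κ 0)
        obtain rfl : l = none := FVA.Step.label_eq_none hst ho
        exact ⟨(p', p.2), hW.abelard p hp (hpq.owner_eq.trans ho) none (p', p.2) ⟨hst', rfl⟩,
          hsim.symm⟩
      · rintro q ⟨p, hp, hpq⟩ ho
        obtain ⟨l, p', -, hst, hp'⟩ := hW.eloise p hp (hpq.owner_eq.trans ho)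
        obtain ⟨q', hst', hsim⟩ := hpq.exists_step hst.1 (FVA.FreshRenaming.copyAt E.κ 0)
        refine ⟨_, q', ?_, hst', p', hp', hsim⟩
        rintro X ρ hl x
        cases l with
        | none => cases hl
        | some r =>
          cases hl
          rfl
    obtain ⟨s', hs', hQ⟩ := hsafe.exists_isWinning
    exact ⟨s', hs', hQ⟩
  · rintro ⟨s, hs, -⟩
    have hW := hs.isSafe
    generalize {p | ∃ h, (FVA.simGame E who t u).IsPlay s h ∧
      (FVA.simGame E who t u).current h = p} = W at hW
    have hsafe : (FVA.simGameHat E who t u).IsSafe (fun _ => True)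
        -- The bound `k` on the copy indices used so far guarantees that index `k` is still free.
        {q | (∃ p ∈ W, FVA.PosSim E.κ p q.1) ∧ ∃ k, ∀ n ∈ q.2, n.2 < k} := by
      refine ⟨⟨⟨_, hW.init, hinit⟩, 0, fun n hn => absurd hn (Set.notMem_empty n)⟩, ?_, ?_⟩
      · rintro q ⟨⟨p, hp, hpq⟩, k, hk⟩ ho l q' ⟨hst, hl⟩
        obtain ⟨p', hst', hsim⟩ := hpq.symm.exists_step hst (FVA.FreshRenaming.copyAt E.κ 0)
        obtain rfl : l = none := FVA.Step.label_eq_none hst ho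
        have hl : q'.2 = q.2 := hl
        exact ⟨⟨p', hW.abelard p hp (hpq.owner_eq.trans ho) none p' hst', hsim.symm⟩, k,
          by rwa [hl]⟩
      · rintro q ⟨⟨p, hp, hpq⟩, k, hk⟩ ho
        obtain ⟨l, p', -, hst, hp'⟩ := hW.eloise p hp (hpq.owner_eq.trans ho)
        obtain ⟨q', hst', hsim⟩ := hpq.exists_step hst (FVA.FreshRenaming.copyAt E.κ k)
        cases l with
        | none => exact ⟨none, (q', q.2), trivial, ⟨hst', rfl⟩, ⟨p', hp', hsim⟩, k, hk⟩
        | some r =>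
          refine ⟨_, (q', q.2 ∪ (FVA.FreshRenaming.copyAt E.κ k r.1).codom), trivial,
            ⟨hst', ?_, rfl⟩, ⟨p', hp', hsim⟩, k + 1, ?_⟩
          · rw [Set.disjoint_left]
            rintro _ ⟨x, rfl⟩ hn
            exact lt_irrefl k (hk _ hn)
          · rintro n (hn | ⟨x, rfl⟩)
            · exact (hk n hn).trans (Nat.lt_succ_self k)
            · exact Nat.lt_succ_self k
    obtain ⟨s', hs', -⟩ := hsafe.exists_isWinning
    exact ⟨s', hs'⟩
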